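/- Let $G=(V,E)$ be a finite connected undirected simple graph and let $k\ge 2$ be an integer. Let $G$ be given by adjacency lists (listing the neighbours $N(v)$ of each vertex $v$ in any order), and let the vertices be listed in the discovery order of an arbitrary depth-first search of $G$. Consider the following algorithm. It keeps global lists $S,N,F,T$, all initially empty; vertices are appended to and removed from the back of these lists only. $\mathrm{Main}$: visit the vertices $v$ from the back to the front of the depth-first search order. For each $v$: set $S=\{v\}$; let $\ell=|N(v)\setminus F|$ and append the vertices of $N(v)\setminus F$ to $F$; call $\mathrm{Enumerate}(S,N,F,\ell)$; append $v$ to $F$; restore $S$ and $N$ to their values before this iteration; stop if $|V|-|F|<k$. $\mathrm{Enumerate}(S,N,F,\ell)$: set a local variable $\mathit{hasSolution}$ to false. If $|S|=k$, output $S$ and return true. Otherwise, if $|S|+|T|=k$, output $S\cup T$, empty $T$, and set $\mathit{hasSolution}$ to true. Then repeat the following for each of the last $\ell$ vertices of $F$, from the back: remove the last vertex $u$ from $F$, append it to $S$, and set $\ell'=0$. If now $|S|<k$, then (i) for every $w\in N(u)\setminus(S\cup N\cup F)$, append $w$ to $N$ if $w\in T$, and otherwise append $w$ to $F$ and increase $\ell'$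 by one; (ii) if $\mathit{hasSolution}$ is true, increase $\ell'$ by $|N|$ and move all vertices of $N$, one by one from its back, to the end of $F$. Call $\mathrm{Enumerate}(S,N,F,\ell')$; if it returns true, set $\mathit{hasSolution}$ to true, and otherwise append $u$ to $T$. Restore $S$ and $N$ to their values at the beginning of this iteration and append $u$ to $N$. After the last iteration, return $\mathit{hasSolution}$. Then the algorithm outputs exactly the sets $C\subseteq V$ with $|C|=k$ for which the induced subgraph $G[C]$ is connected, and it outputs each such set exactly once. -/

import Mathlib

namespace ConnEnum

/-- `DFSRun G r stack order`: `(stack, order)` is a reachable configuration of a depth-first search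
traversal of `G` started at `r`. The head of `stack` is the vertex being processed and `order`
lists the vertices discovered so far, in the order of their discovery. -/
inductive DFSRun {V : Type*} (G : SimpleGraph V) (r : V) : List V → List V → Prop
  | start : DFSRun G r [r] [r]
  | discover {u w : V} {stack order : List V} (h : DFSRun G r (u :: stack) order)
      (hadj : G.Adj u w) (hnew : w ∉ order) : DFSRun G r (w :: u :: stack) (order ++ [w])
  | backtrack {u : V} {stack order : List V} (h : DFSRun G r (u :: stack) order)
      (hdone : ∀ w, G.Adj u w → w ∈ order) : DFSRun G r stack order

/-- `order` is the discovery order of a completed depth-first search traversal of `G`, from some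
root and with arbitrary choices of the next vertex. -/
def IsDFSOrder {V : Type*} (G : SimpleGraph V) (order : List V) : Prop :=
  ∃ r, DFSRun G r [] order

/-- `adj` is an adjacency-list representation of `G`: `adj v` lists every neighbour of `v` exactly
once, in an arbitrary order. -/
def IsAdjacencyLists {V : Type*} (G : SimpleGraph V) (adj : V → List V) : Prop :=
  ∀ v, (adj v).Nodup ∧ ∀ w, w ∈ adj v ↔ G.Adj v w

/-- The global variables of the algorithm: the lists `S`, `N`, `F`, `T`, and the sequence `out` of
all vertex sets output so far, in chronological order. The algorithm accesses `S`, `N`, `F`, `T`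
only at their back; each of these is stored with its back as the head of the Lean list. -/
structure State (V : Type*) where
  S : List V
  N : List V
  F : List V
  T : List V
  out : List (Finset V)

variable {V : Type*} [DecidableEq V]

/-- The loop over `v ∈ N(u) \ (S ∪ N ∪ F)`, whose vertices are listed in the last argument:
append `v` to `N` if it is in `T`, and otherwise append it to `F` and increment `ℓ'`. -/
def absorb : State V → ℕ → List V → State V × ℕ
  | st, l', [] => (st, l')
  | st, l', v :: vs =>
    if v ∈ st.T then absorb { st with N := v :: st.N } l' vs
    else absorb { st with F := v :: st.F } (l' + 1) vs

/-- Move the vertices of `N`, one by one from its back, to the end of `F`. -/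
def reopen (st : State V) : State V :=
  { st with N := [], F := st.N.reverse ++ st.F }

/-- The part of an iteration of `Enumerate` that prepares the recursive call, after `u` has been
moved from `F` to `S`. It returns the new state and `ℓ'`. -/
def expand (k : ℕ) (adj : V → List V) (u : V) (hasSolution : Bool) (st : State V) :
    State V × ℕ :=
  if st.S.length < k then
    let p := absorb st 0 ((adj u).filter fun v => v ∉ st.S ∧ v ∉ st.N ∧ v ∉ st.F)
    if hasSolution then (reopen p.1, p.2 + p.1.N.length) else p
  else (st, 0)

theorem absorb_S (st : State V) (l' : ℕ) (vs : List V) : (absorb st l' vs).1.S = st.S := by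
  induction vs generalizing st l' with
  | nil => rfl
  | cons v vs ih => unfold absorb; split <;> simp [ih]

theorem expand_S (k : ℕ) (adj : V → List V) (u : V) (b : Bool) (st : State V) :
    (expand k adj u b st).1.S = st.S := by
  unfold expand
  split
  · cases b <;> simp [reopen, absorb_S]
  · rfl

theorem expand_snd (k : ℕ) (adj : V → List V) (u : V) (b : Bool) (st : State V)
    (h : ¬ st.S.length < k) : (expand k adj u b st).2 = 0 := by
  simp [expand, h]

mutual

/-- The recursive procedure `Enumerate(S, N, F, ℓ)`, acting on the global state. It returns the
final state and the returned Boolean. -/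
def enumerate (k : ℕ) (adj : V → List V) (st : State V) (l : ℕ) : State V × Bool :=
  if st.S.length = k then
    ({ st with out := st.out ++ [st.S.toFinset] }, true)
  else if st.S.length + st.T.length = k then
    enumerateLoop k adj
      { st with out := st.out ++ [st.S.toFinset ∪ st.T.toFinset], T := [] } l true
  else
    enumerateLoop k adj st l false
termination_by (k - st.S.length, l, 1)

/-- The main loop of `Enumerate`, with `l` iterations left and the current value of the local
variable `hasSolution`. At the end of an iteration `S` and `N` are restored to their values at its
beginning, and then `u` is appended to `N`. -/
def enumerateLoop (k : ℕ) (adj : V → List V) : State V → ℕ → Bool → State V × Bool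
  | st, 0, hasSolution => (st, hasSolution)
  | st, l + 1, hasSolution =>
    match st.F with
    | [] => (st, hasSolution)
    | u :: F =>
      let p := expand k adj u hasSolution { st with F := F, S := u :: st.S }
      let q := enumerate k adj p.1 p.2
      let T := if q.2 then q.1.T else u :: q.1.T
      enumerateLoop k adj { q.1 with S := st.S, N := u :: st.N, T := T } l (hasSolution || q.2)
termination_by st l _ => (k - st.S.length, l, 0)
decreasing_by
  · have hS := expand_S k adj u hasSolution { st with F := F, S := u :: st.S }
    have h0 := expand_snd k adj u hasSolution { st with F := F, S := u :: st.S }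
    simp only [List.length_cons] at hS h0
    rw [hS, List.length_cons]
    by_cases h : st.S.length + 1 < k
    · exact Prod.Lex.left _ _ (by omega)
    · rw [h0 h]
      by_cases h' : k - (st.S.length + 1) < k - st.S.length
      · exact Prod.Lex.left _ _ h'
      · have hk : k - (st.S.length + 1) = k - st.S.length := by omega
        rw [hk]
        exact Prod.Lex.right _ (Prod.Lex.left _ _ (Nat.succ_pos l))
  · exact Prod.Lex.right _ (Prod.Lex.left _ _ (by omega))

end

/-- The loop of `Main` over the vertices still to be visited, given in the order of visiting; `n` is
the number of vertices of the graph. -/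
def mainLoop (k : ℕ) (adj : V → List V) (n : ℕ) : State V → List V → State V
  | st, [] => st
  | st, v :: vs =>
    let new := (adj v).filter fun u => u ∉ st.F
    let st₁ := (enumerate k adj { st with S := [v], F := new.reverse ++ st.F } new.length).1
    let st₂ := { st₁ with F := v :: st₁.F, S := st.S, N := st.N }
    if n < k + st₂.F.length then st₂ else mainLoop k adj n st₂ vs

/-- The procedure `Main`, on a graph given by its adjacency lists `adj` and the list `order` of its
vertices, which is visited from back to front. Its value is the sequence of all vertex sets that
are output, in chronological order. -/
def main (k : ℕ) (adj : V → List V) (order : List V) : List (Finset V) :=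
  (mainLoop k adj order.length ⟨[], [], [], [], []⟩ order.reverse).out

end ConnEnum

-- Read `F` as the set of forbidden vertices. A connected `k`-set is produced under the first of its
-- vertices that `Main` visits. Within a call, sets containing `S` and avoiding the old part `F₀` of
-- `F` are classified by the first of the `ℓ` candidates they contain. A set containing no candidate
-- avoids all of `F`, so it lies in the component of `S` in `G` without `F`. This classification
-- gives uniqueness.
--
-- The delicate point is that this component is never searched for: the list `T` must provide it.
-- Until a solution is found, `S ∪ T` is that component and has at most `k` vertices, so the last
-- class is `{S ∪ T}` or empty. After a success `T` is empty. Every later iteration then succeeds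
-- too: from a solution `D` avoiding the next candidate `u`, the connected set `S ∪ {u}` grows
-- inside `D ∪ {u}` to size `k` (`IsSolution.exists_cons`). Moving `N` back to `F` isolates the new
-- `S`, so an empty `T` is again correct (`LoopInv.expand`).
--
-- Between visits of `Main`, `T` must also be empty. Prefixes of a search order induce connected
-- graphs, so if `k` vertices remain, the visited vertex lies in a connected `k`-set of unforbidden
-- vertices and its call succeeds.

namespace ConnEnum

-- Growing connected induced subgraphs

section Connectivity

variable {V : Type*} {G : SimpleGraph V}

theorem connected_induce_singleton (v : V) : (G.induce ({v} : Set V)).Connected where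
  preconnected a b := by rw [Subsingleton.elim a b]
  nonempty := ⟨⟨v, rfl⟩⟩

theorem connected_induce_insert {C : Set V} {c u : V} (hC : (G.induce C).Connected) (hc : c ∈ C)
    (hcu : G.Adj c u) : (G.induce (insert u C)).Connected := by
  have key : ∀ x : ↥(insert u C), (G.induce (insert u C)).Reachable ⟨c, Or.inr hc⟩ x := by
    rintro ⟨x, rfl | hx⟩
    · exact SimpleGraph.Adj.reachable (by simpa using hcu)
    · exact (hC.preconnected ⟨c, hc⟩ ⟨x, hx⟩).map
        (SimpleGraph.induceHomOfLE G (Set.subset_insert u C)).toHom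
  exact { preconnected := fun a b => (key a).symm.trans (key b), nonempty := ⟨⟨c, Or.inr hc⟩⟩ }

theorem exists_adj_of_connected_induce {C A : Set V} (hC : (G.induce C).Connected) {a b : V}
    (haC : a ∈ C) (haA : a ∈ A) (hbC : b ∈ C) (hbA : b ∉ A) :
    ∃ x ∈ A, ∃ y ∈ C, x ∈ C ∧ y ∉ A ∧ G.Adj x y := by
  obtain ⟨p⟩ := hC.preconnected ⟨a, haC⟩ ⟨b, hbC⟩
  obtain ⟨d, -, h1, h2⟩ := p.exists_boundary_dart (Subtype.val ⁻¹' A) haA hbA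
  exact ⟨d.fst.1, h1, d.snd.1, d.snd.2, d.fst.2, h2, d.adj⟩

theorem subset_of_connected_induce {C A F : Set V} (hC : (G.induce C).Connected) {a : V}
    (haC : a ∈ C) (haA : a ∈ A) (hA : ∀ x ∈ A, ∀ y, G.Adj x y → y ∈ A ∨ y ∈ F)
    (hF : ∀ x ∈ F, x ∉ C) : C ⊆ A := by
  intro b hb
  by_contra hbA
  obtain ⟨x, hx, y, hy, -, hyA, hxy⟩ := exists_adj_of_connected_induce hC haC haA hb hbA
  rcases hA x hx y hxy with h | h
  · exact hyA h
  · exact hF y h hy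

/-- As long as the set is smaller than `D`, connectivity of `D` supplies an edge leaving it inside
`D`, whose far end can be added. -/
theorem exists_connected_between [DecidableEq V] {A D : Finset V} {m : ℕ}
    (hA : (G.induce (A : Set V)).Connected) (hD : (G.induce (D : Set V)).Connected)
    (hAD : A ⊆ D) (hAm : A.card ≤ m) (hmD : m ≤ D.card) :
    ∃ B : Finset V, A ⊆ B ∧ B ⊆ D ∧ B.card = m ∧ (G.induce (B : Set V)).Connected := by
  induction m, hAm using Nat.le_induction with
  | base => exact ⟨A, subset_rfl, hAD, rfl, hA⟩
  | succ m hm ih =>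
    obtain ⟨B, hAB, hBD, hBm, hB⟩ := ih (by omega)
    obtain ⟨b, hbD, hbB⟩ : ∃ b ∈ D, b ∉ B := by
      by_contra! h
      have := Finset.card_le_card (show D ⊆ B from h)
      omega
    obtain ⟨⟨a, ha⟩⟩ := hB.nonempty
    obtain ⟨x, hx, y, hy, -, hyB, hxy⟩ := exists_adj_of_connected_induce (A := (B : Set V)) hD
      (hBD ha) ha hbD hbB
    refine ⟨insert y B, hAB.trans (Finset.subset_insert _ _), Finset.insert_subset hy hBD, ?_, ?_⟩
    · rw [Finset.card_insert_of_notMem hyB, hBm]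
    · rw [Finset.coe_insert]
      exact connected_induce_insert hB hx hxy

end Connectivity

-- Depth-first search orders

section Search

variable {V : Type*} {G : SimpleGraph V} {r : V}

theorem DFSRun.nodup {s o : List V} (h : DFSRun G r s o) : o.Nodup := by
  induction h with
  | start => simp
  | discover _ _ hnew ih => exact List.nodup_append.2 ⟨ih, by simp, by simp; grind⟩
  | backtrack _ _ ih => exact ih

theorem DFSRun.mem_order {s o : List V} (h : DFSRun G r s o) : r ∈ o ∧ ∀ x ∈ s, x ∈ o := by
  induction h with
  | start => simp
  | discover _ _ _ ih => grind
  | backtrack _ _ ih => grind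

/-- A discovered vertex leaves the stack only by backtracking, which requires all its neighbours to
be discovered. -/
theorem DFSRun.closed {s o : List V} (h : DFSRun G r s o) :
    ∀ x ∈ o, x ∉ s → ∀ w, G.Adj x w → w ∈ o := by
  induction h with
  | start => simp
  | discover _ _ _ ih => grind
  | backtrack _ _ ih => grind

/-- A discovery creates only one new prefix, the whole list, and its last vertex is adjacent to an
earlier one. -/
theorem DFSRun.connected_prefix {s o : List V} (h : DFSRun G r s o) :
    ∀ p, p <+: o → p ≠ [] → (G.induce {x | x ∈ p}).Connected := by
  induction h with
  | start =>
    intro p hp hne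
    rcases List.prefix_cons_iff.1 hp with rfl | ⟨t, rfl, ht⟩
    · exact absurd rfl hne
    · rw [List.prefix_nil.1 ht]
      have : {x | x ∈ [r]} = ({r} : Set V) := by simp
      rw [this]
      exact connected_induce_singleton r
  | @discover u w stack order h hadj hnew ih =>
    intro p hp hne
    rcases List.prefix_concat_iff.1 hp with hp | hp
    · have ho : order ≠ [] := List.ne_nil_of_mem h.mem_order.1
      have hu : u ∈ order := h.mem_order.2 u (by simp)
      have hset : {x | x ∈ p} = insert w {x | x ∈ order} := by
        ext x
        simp [hp, or_comm]
      rw [hset]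
      exact connected_induce_insert (C := {x | x ∈ order}) (ih order List.prefix_rfl ho) hu hadj
    · exact ih p hp hne
  | backtrack _ _ ih => exact ih

theorem IsDFSOrder.nodup {o : List V} (h : IsDFSOrder G o) : o.Nodup :=
  let ⟨_, h⟩ := h; h.nodup

theorem IsDFSOrder.connected_prefix {o : List V} (h : IsDFSOrder G o) (p : List V) (hp : p <+: o)
    (hne : p ≠ []) : (G.induce {x | x ∈ p}).Connected :=
  let ⟨_, h⟩ := h; h.connected_prefix p hp hne

theorem IsDFSOrder.mem {o : List V} (h : IsDFSOrder G o) (hG : G.Connected) (v : V) : v ∈ o := by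
  obtain ⟨r, h⟩ := h
  obtain ⟨p⟩ := hG.preconnected r v
  by_contra hv
  obtain ⟨d, -, h1, h2⟩ := p.exists_boundary_dart {x | x ∈ o} h.mem_order.1 hv
  exact h2 (h.closed _ h1 (by simp) _ d.adj)

end Search

-- Solutions, components and the invariants of the recursion

section Invariants

variable {V : Type*} {G : SimpleGraph V}

/-- `C` is a connected `k`-set that contains `S` and avoids `F`. -/
structure IsSolution (G : SimpleGraph V) (k : ℕ) (S F : List V) (C : Finset V) : Prop where
  mem : ∀ x ∈ S, x ∈ C
  notMem : ∀ x ∈ F, x ∉ C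
  card : C.card = k
  connected : (G.induce (C : Set V)).Connected

/-- `N` and `F` together contain the neighbours of the connected set `S`, and `N` contains
only such neighbours. -/
structure IsFrontier (G : SimpleGraph V) (S N F : List V) : Prop where
  connected : (G.induce {x | x ∈ S}).Connected
  nodup_S : S.Nodup
  nodup_N : N.Nodup
  nodup_F : F.Nodup
  notMem_F : ∀ x ∈ S, x ∉ F
  notMem_F' : ∀ x ∈ N, x ∉ F
  notMem_N : ∀ x ∈ S, x ∉ N
  adj : ∀ x ∈ N, ∃ s ∈ S, G.Adj s x
  closed : ∀ s ∈ S, ∀ x, G.Adj s x → x ∈ S ∨ x ∈ N ∨ x ∈ F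

/-- `S` and `T` together are the connected component of `S` in the graph without `F`. -/
structure IsComponent (G : SimpleGraph V) (S F T : List V) : Prop where
  nodup : T.Nodup
  notMem_S : ∀ x ∈ T, x ∉ S
  notMem_F : ∀ x ∈ T, x ∉ F
  connected : (G.induce {x | x ∈ S ∨ x ∈ T}).Connected
  closed : ∀ s, s ∈ S ∨ s ∈ T → ∀ x, G.Adj s x → x ∈ S ∨ x ∈ T ∨ x ∈ F

theorem IsFrontier.exists_mem {S N F : List V} (h : IsFrontier G S N F) : ∃ x, x ∈ S := by
  obtain ⟨x⟩ := h.connected.nonempty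
  exact ⟨x.1, x.2⟩

theorem isSolution_append_iff {k : ℕ} {S L F : List V} {C : Finset V} :
    IsSolution G k S (L ++ F) C ↔ IsSolution G k S F C ∧ ¬ ∃ x ∈ L, x ∈ C := by
  constructor
  · rintro ⟨h1, h2, h3, h4⟩
    exact ⟨⟨h1, fun x hx => h2 x (by simp [hx]), h3, h4⟩,
      fun ⟨x, hx, hx'⟩ => h2 x (by simp [hx]) hx'⟩
  · rintro ⟨⟨h1, h2, h3, h4⟩, h⟩
    refine ⟨h1, fun x hx hxC => ?_, h3, h4⟩
    rcases List.mem_append.1 hx with hx | hx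
    exacts [h ⟨x, hx, hxC⟩, h2 x hx hxC]

theorem isSolution_cons_iff {k : ℕ} {S F : List V} {u : V} {C : Finset V} :
    IsSolution G k (u :: S) F C ↔ IsSolution G k S F C ∧ u ∈ C := by
  constructor
  · rintro ⟨h1, h2, h3, h4⟩
    exact ⟨⟨fun x hx => h1 x (by simp [hx]), h2, h3, h4⟩, h1 u (by simp)⟩
  · rintro ⟨⟨h1, h2, h3, h4⟩, h⟩
    exact ⟨by simpa [h] using h1, h2, h3, h4⟩

variable [DecidableEq V]

theorem IsSolution.subset {k : ℕ} {S F T : List V} {C : Finset V} (h : IsSolution G k S F C)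
    (hT : IsComponent G S F T) {s : V} (hs : s ∈ S) : C ⊆ S.toFinset ∪ T.toFinset := by
  have := subset_of_connected_induce (A := {x | x ∈ S ∨ x ∈ T}) (F := {x | x ∈ F}) h.connected
    (h.mem s hs) (Or.inl hs) (fun x hx y hxy => by
      rcases hT.closed x hx y hxy with h | h | h
      exacts [Or.inl (Or.inl h), Or.inl (Or.inr h), Or.inr h]) h.notMem
  intro x hx
  simpa using this hx

theorem IsComponent.card {S F T : List V} (hT : IsComponent G S F T) (hS : S.Nodup) :
    (S.toFinset ∪ T.toFinset).card = S.length + T.length := by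
  rw [Finset.card_union_of_disjoint, List.toFinset_card_of_nodup hS,
    List.toFinset_card_of_nodup hT.nodup]
  rw [Finset.disjoint_left]
  intro x hx hx'
  exact hT.notMem_S x (by simpa using hx') (by simpa using hx)

theorem IsComponent.not_isSolution {k : ℕ} {S F T : List V} {C : Finset V}
    (hT : IsComponent G S F T) (hS : S.Nodup) {s : V} (hs : s ∈ S)
    (hk : S.length + T.length < k) : ¬ IsSolution G k S F C := by
  intro h
  have h1 := Finset.card_le_card (h.subset hT hs)
  rw [hT.card hS, h.card] at h1
  omega

theorem IsComponent.isSolution_iff {k : ℕ} {S F T : List V} {C : Finset V}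
    (hT : IsComponent G S F T) (hS : S.Nodup) (hSF : ∀ x ∈ S, x ∉ F) {s : V} (hs : s ∈ S)
    (hk : S.length + T.length = k) :
    IsSolution G k S F C ↔ C = S.toFinset ∪ T.toFinset := by
  constructor
  · intro h
    refine Finset.eq_of_subset_of_card_le (h.subset hT hs) ?_
    rw [hT.card hS, h.card, hk]
  · rintro rfl
    refine ⟨by simp +contextual, fun x hx => ?_, by rw [hT.card hS, hk], ?_⟩
    · have := hSF x
      have := hT.notMem_F x
      simp only [Finset.mem_union, List.mem_toFinset]
      tauto
    · have : ((S.toFinset ∪ T.toFinset : Finset V) : Set V) = {x | x ∈ S ∨ x ∈ T} := by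
        ext x; simp
      rw [this]
      exact hT.connected

theorem isSolution_full_iff {k : ℕ} {S F : List V} {C : Finset V} (hS : S.Nodup)
    (hc : (G.induce {x | x ∈ S}).Connected) (hSF : ∀ x ∈ S, x ∉ F) (hk : S.length = k) :
    IsSolution G k S F C ↔ C = S.toFinset := by
  have hcard := List.toFinset_card_of_nodup hS
  constructor
  · intro h
    refine (Finset.eq_of_subset_of_card_le (fun x hx => h.mem x (by simpa using hx)) ?_).symm
    rw [hcard, h.card, hk]
  · rintro rfl
    refine ⟨by simp, fun x hx h => hSF x (by simpa using h) hx, by omega, ?_⟩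
    have : (S.toFinset : Set V) = {x | x ∈ S} := by ext x; simp
    rwa [this]

/-- The effect of a part of `Enumerate` with current set `S` on the state: it consumes `F` down to
`F₀`, and outputs the sets with property `P`, each exactly once. -/
structure Result (G : SimpleGraph V) (k : ℕ) (S F₀ T₀ : List V) (o : List (Finset V))
    (P : Finset V → Prop) (r : State V × Bool) : Prop where
  F : r.1.F = F₀
  out : ∃ o', r.1.out = o ++ o' ∧ o'.Nodup ∧ ∀ C, C ∈ o' ↔ P C
  success : r.2 = true → r.1.T = [] ∧ ∃ D, IsSolution G k S F₀ D
  failure : r.2 = false → IsComponent G S F₀ r.1.T ∧ S.length + r.1.T.length < k ∧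
    ∀ x ∈ T₀, x ∈ r.1.T

/-- What `Enumerate` may assume when called with `|S| < k`. -/
structure Ready (G : SimpleGraph V) (k : ℕ) (st : State V) : Prop where
  frontier : IsFrontier G st.S st.N st.F
  component : IsComponent G st.S st.F st.T
  subset : ∀ x ∈ st.N, x ∈ st.T
  card : st.S.length + st.T.length ≤ k

/-- The invariant of the loop of `Enumerate`. -/
structure LoopInv (G : SimpleGraph V) (k : ℕ) (st : State V) (b : Bool) : Prop where
  frontier : IsFrontier G st.S st.N st.F
  failing : b = false → IsComponent G st.S st.F st.T ∧ (∀ x ∈ st.N, x ∈ st.T) ∧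
    st.S.length + st.T.length < k
  solved : b = true → st.T = [] ∧ ∃ D, IsSolution G k st.S st.F D

end Invariants

-- Preparing a recursive call

section Expansion

variable {V : Type*} [DecidableEq V] {G : SimpleGraph V}

theorem absorb_eq (st : State V) (l : ℕ) (vs : List V) :
    absorb st l vs = ({ st with
      N := (vs.filter (· ∈ st.T)).reverse ++ st.N
      F := (vs.filter (· ∉ st.T)).reverse ++ st.F },
      l + (vs.filter (· ∉ st.T)).length) := by
  induction vs generalizing st l with
  | nil => simp [absorb]
  | cons v vs ih =>
    unfold absorb
    split
    · rw [ih]; simp [*]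
    · rw [ih]; simp [*]; omega

/-- Preparing the recursive call on `u` establishes what that call assumes. -/
theorem LoopInv.expand {k : ℕ} {adj : V → List V} (hadj : IsAdjacencyLists G adj) {st : State V}
    {b : Bool} {u : V} {R : List V} (h : LoopInv G k st b) (hF : st.F = u :: R)
    (hu : ∃ s ∈ st.S, G.Adj s u) (hk : st.S.length + 1 < k) :
    ∃ st' L, expand k adj u b { st with F := R, S := u :: st.S } = (st', L.length) ∧
      Ready G k st' ∧ st'.S = u :: st.S ∧ st'.F = L ++ R ∧ st'.T = st.T ∧ st'.out = st.out ∧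
      ∀ x ∈ L, ∃ s ∈ st'.S, G.Adj s x := by
  obtain ⟨S, N, F, T, out⟩ := st
  obtain ⟨fr, hf, hs⟩ := h
  obtain ⟨conn, ndS, ndN, ndF, SF, NF, SN, adjN, cl⟩ := fr
  obtain ⟨s, hsS, hsu⟩ := hu
  dsimp only at *
  subst hF
  have hSF : u ∉ S := fun hu => SF u hu (by simp)
  have conn' : (G.induce {x | x ∈ u :: S}).Connected := by
    have : {x | x ∈ u :: S} = insert u {x | x ∈ S} := by ext x; simp
    rw [this]
    exact connected_induce_insert (C := {x | x ∈ S}) conn hsS hsu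
  obtain ⟨ndu, memu⟩ := hadj u
  have ndR := (List.nodup_cons.1 ndF)
  cases b with
  | false =>
    -- No solution so far: new neighbours of `u` outside `T` become forbidden, so adding `u` to the
    -- component `S ∪ T` keeps it closed. The strict bound on its size leaves room for `u`.
    obtain ⟨hT, hNT, hc⟩ := hf rfl
    obtain ⟨ndT, TS, TF, connT, clT⟩ := hT
    simp only [ConnEnum.expand, List.length_cons, hk, if_true, absorb_eq, zero_add]
    refine ⟨_, List.reverse _, by rw [List.length_reverse]; rfl, ?_, rfl, rfl, rfl, rfl, ?_⟩
    · constructor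
      · constructor
        · exact conn'
        · simp [*]
        · refine List.nodup_append.2 ⟨?_, ndN, ?_⟩
          · exact List.nodup_reverse.2 ((ndu.filter _).filter _)
          · simp; grind
        · refine List.nodup_append.2 ⟨?_, ndR.2, ?_⟩
          · exact List.nodup_reverse.2 ((ndu.filter _).filter _)
          · simp; grind
        · simp; grind
        · simp; grind
        · simp; grind
        · simp; grind
        · simp; grind
      · constructor
        · exact ndT
        · simp; grind
        · simp; grind
        · have : {x | x ∈ u :: S ∨ x ∈ T} = insert u {x | x ∈ S ∨ x ∈ T} := by
            ext x; simp [or_assoc]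
          dsimp only
          rw [this]
          exact connected_induce_insert (C := {x | x ∈ S ∨ x ∈ T}) connT (Or.inl hsS) hsu
        · simp; grind
      · simp; grind
      · simp; omega
    · simp; grind
  | true =>
    -- With `T` empty, all new neighbours of `u` and all of `N` end up in `F`, so `u :: S` is a
    -- component by itself.
    obtain ⟨rfl, -⟩ := hs rfl
    simp only [ConnEnum.expand, List.length_cons, hk, if_true, absorb_eq, zero_add, reopen]
    refine ⟨_, N.reverse ++ List.reverse ((adj u).filter
      fun v => v ∉ u :: S ∧ v ∉ N ∧ v ∉ R), Prod.ext rfl ?_, ?_, rfl, ?_, rfl, rfl, ?_⟩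
    · simp; omega
    rotate_left
    · simp
    · simp; grind
    · constructor
      · constructor
        · exact conn'
        · simp [*]
        · simp
        · simp only [List.not_mem_nil, not_false_eq_true, decide_true, decide_false,
            List.filter_true, List.filter_false, List.reverse_nil, List.nil_append]
          refine List.nodup_append.2 ⟨List.nodup_reverse.2 ndN,
            List.nodup_append.2 ⟨List.nodup_reverse.2 (ndu.filter _), ndR.2, ?_⟩, ?_⟩
          · simp; grind
          · simp; grind
        · simp; grind
        · simp
        · simp
        · simp
        · simp; grind
      · constructor
        · simp
        · simp
        · simp
        · have : {x | x ∈ u :: S ∨ x ∈ []} = {x | x ∈ u :: S} := by ext x; simp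
          dsimp only
          rwa [this]
        · simp; grind
      · simp
      · simp; omega

end Expansion

-- Correctness of `Enumerate`

section Correctness

variable {V : Type*} [DecidableEq V] {G : SimpleGraph V} {k : ℕ} {adj : V → List V}

/-- A solution that avoids `u` can be exchanged for one that contains `u`. -/
theorem IsSolution.exists_cons {S N F : List V} {u : V} {D : Finset V}
    (hD : IsSolution G k S F D) (hS : IsFrontier G S N F) (hF : u ∈ F)
    {R : List V} (hR : ∀ x ∈ R, x ∈ F ∧ x ≠ u) (hu : ∃ s ∈ S, G.Adj s u) (hk : S.length < k) :
    ∃ C, IsSolution G k (u :: S) R C := by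
  obtain ⟨s, hs, hsu⟩ := hu
  have huS : u ∉ S := fun h => hS.notMem_F u h hF
  have hSu : (G.induce ((insert u S.toFinset : Finset V) : Set V)).Connected := by
    have : ((insert u S.toFinset : Finset V) : Set V) = insert u {x | x ∈ S} := by ext x; simp
    rw [this]
    exact connected_induce_insert (C := {x | x ∈ S}) hS.connected hs hsu
  have hDu : (G.induce ((insert u D : Finset V) : Set V)).Connected := by
    rw [Finset.coe_insert]
    exact connected_induce_insert hD.connected (hD.mem s hs) hsu
  -- Growing `S ∪ {u}` only inside `D ∪ {u}` keeps the result disjoint from `R`.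
  obtain ⟨B, h1, h2, h3, h4⟩ := exists_connected_between (m := k) hSu hDu
    (Finset.insert_subset_insert _ fun x hx => hD.mem x (by simpa using hx))
    (by
      rw [Finset.card_insert_of_notMem (by simpa using huS), List.toFinset_card_of_nodup hS.nodup_S]
      omega)
    (by rw [← hD.card]; exact Finset.card_le_card (Finset.subset_insert _ _))
  refine ⟨B, fun x hx => h1 (by simpa using hx), fun x hx hxB => ?_, h3, h4⟩
  rcases Finset.mem_insert.1 (h2 hxB) with h | h
  · exact (hR x hx).2 h
  · exact hD.notMem x (hR x hx).1 h

/-- The specification of `Enumerate` for sets `S` of size `n`. -/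
def EnumerateSpec (G : SimpleGraph V) (k : ℕ) (adj : V → List V) (n : ℕ) : Prop :=
  ∀ (st : State V) (L F₀ : List V), st.S.length = n → Ready G k st → st.F = L ++ F₀ →
    (∀ x ∈ L, ∃ s ∈ st.S, G.Adj s x) →
    Result G k st.S F₀ st.T st.out (IsSolution G k st.S F₀) (enumerate k adj st L.length)

theorem LoopInv.result_call (hadj : IsAdjacencyLists G adj) {st : State V} {b : Bool} {u : V}
    {R : List V} (h : LoopInv G k st b) (hF : st.F = u :: R) (hu : ∃ s ∈ st.S, G.Adj s u)
    (hk : st.S.length < k)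
    (ih : st.S.length + 1 < k → EnumerateSpec G k adj (st.S.length + 1)) :
    Result G k (u :: st.S) R st.T st.out (IsSolution G k (u :: st.S) R)
      (enumerate k adj (ConnEnum.expand k adj u b { st with F := R, S := u :: st.S }).1
        (ConnEnum.expand k adj u b { st with F := R, S := u :: st.S }).2) := by
  by_cases hlt : st.S.length + 1 < k
  · obtain ⟨st', L, he, hr, hS, hF', hT, ho, hL⟩ := h.expand hadj hF hu hlt
    rw [he, ← hS, ← hT, ← ho]
    exact ih hlt st' L R (by simp [hS]) hr hF' hL
  · have hk' : st.S.length + 1 = k := by omega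
    -- In the failing case, `|S| + |T| < k` with `|S| = k - 1` leaves no room for `T`.
    have hT : st.T = [] := by
      cases b with
      | false =>
        have := (h.failing rfl).2.2
        exact List.eq_nil_of_length_eq_zero (by omega)
      | true => exact (h.solved rfl).1
    have he : ConnEnum.expand k adj u b { st with F := R, S := u :: st.S } =
        ({ st with F := R, S := u :: st.S }, 0) := by
      simp [ConnEnum.expand, hlt]
    have hfr := h.frontier
    have huF : u ∈ st.F := by simp [hF]
    have hnd : (u :: st.S).Nodup :=
      List.nodup_cons.2 ⟨fun hu => hfr.notMem_F u hu huF, hfr.nodup_S⟩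
    have hconn : (G.induce {x | x ∈ u :: st.S}).Connected := by
      obtain ⟨s, hs, hsu⟩ := hu
      have : {x | x ∈ u :: st.S} = insert u {x | x ∈ st.S} := by ext x; simp
      rw [this]
      exact connected_induce_insert (C := {x | x ∈ st.S}) hfr.connected hs hsu
    have hdisj : ∀ x ∈ u :: st.S, x ∉ R := by
      have h1 := hfr.nodup_F
      have h2 := hfr.notMem_F
      rw [hF] at h1 h2
      simp at h1 h2 ⊢
      grind
    have hsol := fun C => isSolution_full_iff (G := G) (k := k) (C := C) hnd hconn hdisj
      (by simpa using hk')
    rw [he]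
    unfold enumerate
    simp only [List.length_cons, hk', if_true]
    exact ⟨rfl, ⟨[(u :: st.S).toFinset], rfl, by simp, by simp [hsol]⟩,
      fun _ => ⟨hT, _, (hsol _).2 rfl⟩, by simp⟩

/-- An iteration of the loop of `Enumerate` preserves the loop invariant. -/
theorem LoopInv.step {st : State V} {b : Bool} {u : V} {R : List V} (h : LoopInv G k st b)
    (hF : st.F = u :: R) (hu : ∃ s ∈ st.S, G.Adj s u) (hk : st.S.length < k)
    {q : State V × Bool} {P : Finset V → Prop}
    (hq : Result G k (u :: st.S) R st.T st.out P q) :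
    LoopInv G k { q.1 with S := st.S, N := u :: st.N, T := if q.2 then q.1.T else u :: q.1.T }
      (b || q.2) := by
  obtain ⟨S, N, F, T, out⟩ := st
  dsimp only at *
  subst hF
  have fr := h.frontier
  have fr' := fr
  obtain ⟨conn, ndS, ndN, ndF, SF, NF, SN, adjN, cl⟩ := fr
  dsimp only at *
  have huS : u ∉ S := fun h => SF u h (by simp)
  have ndR := List.nodup_cons.1 ndF
  refine ⟨?_, ?_, ?_⟩
  · dsimp only
    rw [hq.F]
    constructor
    · exact conn
    · exact ndS
    · exact List.nodup_cons.2 ⟨fun h => NF u h (by simp), ndN⟩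
    · exact ndR.2
    · grind
    · grind
    · grind
    · grind
    · simp; grind
  · intro hb
    obtain ⟨hb, hq2⟩ := Bool.or_eq_false_iff.1 hb
    obtain ⟨hc, hl, hs⟩ := hq.failure hq2
    obtain ⟨-, hNT, -⟩ := h.failing hb
    -- A failing call only enlarges `T`, so `N ⊆ T` survives. Moving `u` from `S` to `T` leaves the
    -- component unchanged.
    dsimp only at *
    rw [hq.F]
    simp only [hq2, Bool.false_eq_true, if_false]
    obtain ⟨ndT, TS, TF, connT, clT⟩ := hc
    refine ⟨⟨?_, ?_, ?_, ?_, ?_⟩, ?_, ?_⟩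
    · grind
    · grind
    · grind
    · have : {x | x ∈ S ∨ x ∈ u :: q.1.T} = {x | x ∈ u :: S ∨ x ∈ q.1.T} := by
        ext x; simp; tauto
      rwa [this]
    · simp; grind
    · grind
    · simp at hl ⊢; omega
  · intro hb
    -- If an earlier iteration succeeded, the exchange argument yields a solution through `u`, but a
    -- failed call leaves a component with fewer than `k` vertices.
    have hq2 : q.2 = true := by
      by_contra hq2
      have hq2 : q.2 = false := by simpa using hq2
      obtain ⟨hc, hl, -⟩ := hq.failure hq2
      obtain ⟨-, D, hD⟩ := h.solved (by simpa [hq2] using hb)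
      obtain ⟨C, hC⟩ := hD.exists_cons fr' (u := u) (by simp) (R := R) (by grind) hu hk
      exact hc.not_isSolution (List.nodup_cons.2 ⟨huS, ndS⟩) (s := u) (by simp) hl hC
    obtain ⟨hT, D, hD⟩ := hq.success hq2
    dsimp only
    rw [hq.F]
    simp only [hq2, if_true]
    exact ⟨hT, D, (isSolution_cons_iff.1 hD).1⟩

/-- Each iteration yields the sets whose first element in `L` is `u`. The final clause records that
`hasSolution` is never reset, so a failing loop consists of failing calls only. -/
theorem LoopInv.result (hadj : IsAdjacencyLists G adj) {n : ℕ} (hk : n < k)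
    (ih : n + 1 < k → EnumerateSpec G k adj (n + 1)) (F₀ : List V) (L : List V) (st : State V)
    (b : Bool) (h : LoopInv G k st b) (hn : st.S.length = n) (hF : st.F = L ++ F₀)
    (hL : ∀ x ∈ L, ∃ s ∈ st.S, G.Adj s x) :
    Result G k st.S F₀ st.T st.out (fun C => IsSolution G k st.S F₀ C ∧ ∃ x ∈ L, x ∈ C)
      (enumerateLoop k adj st L.length b) ∧
    (b = true → (enumerateLoop k adj st L.length b).2 = true) := by
  induction L generalizing st b with
  | nil =>
    rw [List.nil_append] at hF
    rw [List.length_nil, enumerateLoop]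
    refine ⟨⟨hF, ⟨[], by simp, by simp, by simp⟩, ?_, ?_⟩, id⟩
    · intro hb
      rw [← hF]
      exact h.solved hb
    · intro hb
      rw [← hF]
      exact ⟨(h.failing hb).1, (h.failing hb).2.2, fun _ hx => hx⟩
  | cons u L ihL =>
    rw [List.cons_append] at hF
    have hu := hL u (by simp)
    have hq := h.result_call hadj hF hu (by omega) (by rwa [hn])
    rw [List.length_cons, enumerateLoop]
    split
    · simp_all
    · rename_i v F' hF'
      obtain ⟨rfl, rfl⟩ : u = v ∧ L ++ F₀ = F' := by simpa [hF] using hF'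
      set q := enumerate k adj
        (ConnEnum.expand k adj u b { st with F := L ++ F₀, S := u :: st.S }).1
        (ConnEnum.expand k adj u b { st with F := L ++ F₀, S := u :: st.S }).2
      have hstep := h.step hF hu (by omega) hq
      obtain ⟨hr, hb⟩ := ihL _ _ hstep hn hq.F (fun x hx => hL x (by simp [hx]))
      refine ⟨⟨hr.F, ?_, hr.success, ?_⟩, fun h => hb (by simp [h])⟩
      · obtain ⟨o₁, ho₁, nd₁, mem₁⟩ := hq.out
        obtain ⟨o₂, ho₂, nd₂, mem₂⟩ := hr.out
        refine ⟨o₁ ++ o₂, by rw [ho₂]; dsimp only; rw [ho₁, List.append_assoc], ?_, ?_⟩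
        -- Sets from the current call avoid the remaining candidates, whereas later ones contain one
        -- of them.
        · refine List.nodup_append'.2 ⟨nd₁, nd₂, fun C h₁ h₂ => ?_⟩
          rw [mem₁, isSolution_cons_iff, isSolution_append_iff] at h₁
          exact h₁.1.2 ((mem₂ C).1 h₂).2
        · intro C
          rw [List.mem_append, mem₁, mem₂, isSolution_cons_iff, isSolution_append_iff]
          simp only [List.mem_cons, exists_eq_or_imp]
          tauto
      · intro hf
        obtain ⟨h1, h2, h3⟩ := hr.failure hf
        refine ⟨h1, h2, fun x hx => h3 x ?_⟩
        have hbq : (b || q.2) = false := by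
          by_contra hbq
          rw [hb (Bool.eq_true_of_not_eq_false hbq)] at hf
          cases hf
        have hq2 := (Bool.or_eq_false_iff.1 hbq).2
        have := (hq.failure hq2).2.2 x hx
        dsimp only
        simp [hq2, this]

/-- Downward induction on `|S|`. The loop covers the solutions that meet `L`; the others avoid all
of `F`, and the component `S ∪ T` is the only possible one, provided it has `k` vertices. -/
theorem enumerateSpec (hadj : IsAdjacencyLists G adj) {n : ℕ} (hn : n < k) :
    EnumerateSpec G k adj n := by
  induction hd : k - n generalizing n with
  | zero => omega
  | succ d ihd =>
    intro st L F₀ hS hr hF hL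
    have ih : n + 1 < k → EnumerateSpec G k adj (n + 1) := fun h => ihd h (by omega)
    have hfr := hr.frontier
    obtain ⟨s, hs⟩ := hfr.exists_mem
    unfold enumerate
    rw [if_neg (by omega)]
    split
    · rename_i hk
      have hsol := fun C => hr.component.isSolution_iff (k := k) (C := C) hfr.nodup_S
        hfr.notMem_F hs hk
      have hinv : LoopInv G k
          { st with out := st.out ++ [st.S.toFinset ∪ st.T.toFinset], T := [] } true :=
        ⟨hfr, by simp, fun _ => ⟨rfl, _, (hsol _).2 rfl⟩⟩
      obtain ⟨hres, hb⟩ := hinv.result hadj hn ih F₀ L _ _ hS hF hL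
      obtain ⟨o, ho, nd, mem⟩ := hres.out
      rw [hF] at hsol
      refine ⟨hres.F, ⟨(st.S.toFinset ∪ st.T.toFinset) :: o, by simp [ho], ?_, ?_⟩, hres.success,
        by simp [hb rfl]⟩
      · refine List.nodup_cons.2 ⟨fun h => ?_, nd⟩
        exact (isSolution_append_iff.1 ((hsol _).2 rfl)).2 ((mem _).1 h).2
      · intro C
        rw [List.mem_cons, ← hsol, mem, isSolution_append_iff]
        dsimp only
        tauto
    · rename_i hk
      have hlt : st.S.length + st.T.length < k := lt_of_le_of_ne hr.card hk
      have hinv : LoopInv G k st false :=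
        ⟨hfr, fun _ => ⟨hr.component, hr.subset, hlt⟩, by simp⟩
      obtain ⟨hres, -⟩ := hinv.result hadj hn ih F₀ L _ _ hS hF hL
      obtain ⟨o, ho, nd, mem⟩ := hres.out
      refine ⟨hres.F, ⟨o, ho, nd, fun C => ?_⟩, hres.success, hres.failure⟩
      have := hr.component.not_isSolution (C := C) hfr.nodup_S hs hlt
      rw [hF, isSolution_append_iff] at this
      rw [mem]
      tauto

end Correctness

-- Correctness of `Main`

section Main

variable {V : Type*} [DecidableEq V] {G : SimpleGraph V} {k : ℕ} {adj : V → List V}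

theorem isSolution_nil_lt {F vs : List V} (hall : ∀ x, x ∈ F ∨ x ∈ vs) (hlt : vs.length < k)
    (C : Finset V) : ¬ IsSolution G k [] F C := by
  intro h
  have : C ⊆ vs.toFinset := fun x hx => by
    rcases hall x with hF | hv
    · exact absurd hx (h.notMem x hF)
    · simpa using hv
  have h1 := Finset.card_le_card this
  have h2 := List.toFinset_card_le vs
  have := h.card
  omega

/-- If the vertices `vs` still to be visited induce connected graphs on all suffixes, `Main`
outputs the connected `k`-sets among them, each exactly once. -/
theorem mainLoop_out (hadj : IsAdjacencyLists G adj) (hk : 2 ≤ k) (n : ℕ) (vs : List V)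
    (st : State V) (hS : st.S = []) (hN : st.N = []) (hT : st.T = []) (hF : st.F.Nodup)
    (hvs : vs.Nodup) (hdisj : ∀ x ∈ vs, x ∉ st.F) (hall : ∀ x, x ∈ st.F ∨ x ∈ vs)
    (hn : n = st.F.length + vs.length)
    (hconn : ∀ p, p <:+ vs → p ≠ [] → (G.induce {x | x ∈ p}).Connected) :
    ∃ o, (mainLoop k adj n st vs).out = st.out ++ o ∧ o.Nodup ∧
      ∀ C, C ∈ o ↔ IsSolution G k [] st.F C := by
  induction vs generalizing st with
  | nil =>
    exact ⟨[], by simp [mainLoop], by simp, fun C => by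
      simpa using isSolution_nil_lt hall (by simp; omega) C⟩
  | cons v vs ih =>
    obtain ⟨S, N, F, T, out⟩ := st
    dsimp only at *
    subst hS hN hT
    rw [mainLoop]
    dsimp only
    set new := (adj v).filter fun u => u ∉ F with hnew
    obtain ⟨ndv, memv⟩ := hadj v
    have hvF := hdisj v (by simp)
    have hsing : (G.induce {x | x ∈ [v]}).Connected := by
      have : {x | x ∈ [v]} = ({v} : Set V) := by ext x; simp
      rw [this]
      exact connected_induce_singleton v
    -- All neighbours of `v` are forbidden at this point, so `{v}` is its own component and `T = []`
    -- is correct.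
    have hready : Ready G k ⟨[v], [], new.reverse ++ F, [], out⟩ := by
      have hvv : ¬ G.Adj v v := G.loopless.irrefl v
      refine ⟨⟨hsing, by simp, by simp, ?_, ?_, by simp, by simp, by simp, ?_⟩,
        ⟨by simp, by simp, by simp, ?_, ?_⟩, by simp, by simp; omega⟩
      · refine List.nodup_append.2 ⟨List.nodup_reverse.2 (ndv.filter _), hF, ?_⟩
        simp [hnew]; grind
      · simp [hnew]; grind
      · simp [hnew]; grind
      · have : {x | x ∈ [v] ∨ x ∈ []} = {x | x ∈ [v]} := by ext x; simp
        dsimp only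
        rwa [this]
      · simp [hnew]; grind
    have hres := enumerateSpec hadj (n := 1) (by omega) _ new.reverse F rfl hready rfl
      (by simp [hnew]; grind)
    rw [List.length_reverse] at hres
    dsimp only at hres
    set q := enumerate k adj ⟨[v], [], new.reverse ++ F, [], out⟩ new.length
    obtain ⟨o₁, ho₁, nd₁, mem₁⟩ := hres.out
    have hsplit : ∀ C, IsSolution G k [] F C ↔
        IsSolution G k [v] F C ∨ IsSolution G k [] (v :: F) C := by
      intro C
      rw [show v :: F = [v] ++ F from rfl, isSolution_append_iff, isSolution_cons_iff]
      simp
      tauto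
    have hall' : ∀ x, x ∈ v :: F ∨ x ∈ vs := by
      intro x
      have := hall x
      simp at this ⊢
      tauto
    simp only [hres.F]
    split
    · rename_i hlt
      refine ⟨o₁, ho₁, nd₁, fun C => ?_⟩
      -- Stopping is harmless: fewer than `k` vertices remain unforbidden.
      have := isSolution_nil_lt (G := G) (k := k) hall' (by simp at hlt hn; omega) C
      rw [mem₁, hsplit]
      tauto
    · rename_i hge
      have hlen : k ≤ vs.length := by simp at hge hn; omega
      -- `v :: vs` is connected with more than `k` vertices, so `{v}` grows inside it to a solution
      -- and the call cannot fail.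
      have hqT : q.1.T = [] := by
        cases hq2 : q.2 with
        | true => exact (hres.success hq2).1
        | false =>
          exfalso
          obtain ⟨hc, hl, -⟩ := hres.failure hq2
          obtain ⟨B, hB1, hB2, hB3, hB4⟩ := exists_connected_between (G := G) (m := k) (A := {v})
            (D := (v :: vs).toFinset) (by
              rw [Finset.coe_singleton]; exact connected_induce_singleton v) (by
              have : (((v :: vs).toFinset : Finset V) : Set V) = {x | x ∈ v :: vs} := by ext x; simp
              rw [this]
              exact hconn _ List.suffix_rfl (by simp)) (by simp) (by simp; omega) (by
              rw [List.toFinset_card_of_nodup hvs, List.length_cons]; omega)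
          refine hc.not_isSolution (C := B) (by simp) (s := v) (by simp) hl ⟨?_, ?_, hB3, hB4⟩
          · simpa using hB1
          · intro x hx hxB
            exact hdisj x (by simpa using hB2 hxB) hx
      obtain ⟨o₂, ho₂, nd₂, mem₂⟩ := ih ⟨[], [], v :: F, q.1.T, q.1.out⟩ rfl rfl hqT
        (List.nodup_cons.2 ⟨hvF, hF⟩) (List.nodup_cons.1 hvs).2
        (by have := (List.nodup_cons.1 hvs).1; simp; grind) hall' (by simp at hn ⊢; omega)
        (fun p hp => hconn p (hp.trans (List.suffix_cons _ _)))
      refine ⟨o₁ ++ o₂, by rw [ho₂]; dsimp only; rw [ho₁, List.append_assoc], ?_, fun C => ?_⟩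
      · refine List.nodup_append'.2 ⟨nd₁, nd₂, fun C h₁ h₂ => ?_⟩
        exact ((mem₂ C).1 h₂).notMem v (by simp) (((mem₁ C).1 h₁).mem v (by simp))
      · rw [List.mem_append, mem₁, mem₂, hsplit]

end Main

end ConnEnum

theorem lemma1 {V : Type*} [Fintype V] [DecidableEq V] (G : SimpleGraph V) (hG : G.Connected)
    (adj : V → List V) (hadj : ConnEnum.IsAdjacencyLists G adj)
    (order : List V) (horder : ConnEnum.IsDFSOrder G order)
    (k : ℕ) (hk : 2 ≤ k) :
    (ConnEnum.main k adj order).Nodup ∧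
      ∀ C : Finset V, C ∈ ConnEnum.main k adj order ↔
        C.card = k ∧ (G.induce (C : Set V)).Connected := by
  obtain ⟨o, ho, nd, mem⟩ := ConnEnum.mainLoop_out hadj hk order.length order.reverse
    ⟨[], [], [], [], []⟩ rfl rfl rfl (by simp) (by simpa using horder.nodup) (by simp)
    (by simpa using horder.mem hG) (by simp) (by
      -- `Main` visits from the back, so suffixes of the visiting order are reversed prefixes of the
      -- search order.
      intro p hp hne
      have := horder.connected_prefix p.reverse
        (by simpa using List.reverse_prefix.2 hp) (by simpa using hne)
      have hset : {x | x ∈ p.reverse} = {x | x ∈ p} := by ext x; simp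
      rwa [hset] at this)
  rw [List.nil_append] at ho
  rw [ConnEnum.main, ho]
  refine ⟨nd, fun C => ?_⟩
  rw [mem]
  exact ⟨fun h => ⟨h.card, h.connected⟩, fun h => ⟨by simp, by simp, h.1, h.2⟩⟩
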